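/- Let $c>0$ and let $\mathcal L_c f=-\frac{d}{dx}\big[(1-x^2)f'\big]+c^2x^2f$ on $I=[-1,1]$, whose eigenfunctions are the functions $f\in C^2(I)$, $f\not\equiv 0$, with $\mathcal L_c f=\chi f$ on $(-1,1)$ for some real $\chi$. For $n\ge 0$ let $\chi_n=\chi_n(c)$ be the $n$-th eigenvalue of $\mathcal L_c$, the eigenvalues being arranged in increasing order $\chi_0<\chi_1<\cdots$, and let $\psi_n=\psi_{n,c}$ be the $n$-th prolate spheroidal wave function of bandwidth $c$, i.e. the real eigenfunction of $\mathcal L_c$ for $\chi_n$ normalized by $\int_{-1}^1|\psi_n|^2\,dx=1$ and by $\psi_n(0)>0$ if $n$ is even, $\psi_n'(0)>0$ if $n$ is odd. Assume that $c^2<\chi_n$. Then $\psi_n$ is infinitely differentiable on $(-1,1)$, and for every integer $k\ge 0$ with $k(k+1)\le\chi_n$, $$\left|\psi_n^{(k)}(0)\right|\le(\sqrt{\chi_n})^k\left(|\psi_n(0)|^2+\chi_n^{-1}|\psi_n'(0)|^2\right)^{1/2}.$$ Moreover, the derivatives at $0$ of the same parity as $n$ alternate in sign in this range: for every integer $k\ge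 0$ with $k(k+1)\le\chi_n$ and $k\equiv n \pmod 2$, the numbers $\psi_n^{(k)}(0)$ and $\psi_n^{(k+2)}(0)$ are nonzero and of opposite signs. -/

import Mathlib

open scoped ContDiff

/-- The Sturm-Liouville operator
`L_c(f)(x) = - d/dx [(1 - x^2) f'(x)] + c^2 x^2 f(x)`. -/
noncomputable def prolateOp (c : ℝ) (f : ℝ → ℝ) (x : ℝ) : ℝ :=
  -deriv (fun t => (1 - t ^ 2) * deriv f t) x + c ^ 2 * x ^ 2 * f x

/-- `f` is an eigenfunction of `L_c` on `I = [-1, 1]` with eigenvalue `χ`: it is twice continuously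
differentiable on the closed interval (this is the regularity at the singular end points `±1` that
selects the self-adjoint realization of `L_c` on `L²(I)`), it does not vanish identically on
`I`, and `L_c f = χ f` in the interior. The values of `f` outside `I` play no role. -/
structure IsProlateEigenfunction (c χ : ℝ) (f : ℝ → ℝ) : Prop where
  contDiffOn : ContDiffOn ℝ 2 f (Set.Icc (-1) 1)
  ne_zero : ∃ x ∈ Set.Icc (-1 : ℝ) 1, f x ≠ 0
  eq : ∀ x ∈ Set.Ioo (-1 : ℝ) 1, prolateOp c f x = χ * f x

/-- The set of eigenvalues of `L_c`. -/
def prolateEigenvalues (c : ℝ) : Set ℝ :=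
  {χ | ∃ f : ℝ → ℝ, IsProlateEigenfunction c χ f}

/-- `χ = χ_n(c)`: when the eigenvalues of `L_c` are arranged in increasing order
`χ_0(c) < χ_1(c) < ...`, the `n`-th one is `χ`, that is, `χ` is an eigenvalue and exactly `n`
eigenvalues lie strictly below it. -/
def IsNthProlateEigenvalue (c : ℝ) (n : ℕ) (χ : ℝ) : Prop :=
  χ ∈ prolateEigenvalues c ∧ {μ ∈ prolateEigenvalues c | μ < χ}.encard = n

/-- `ψ = ψ_{n,c}` is the `n`-th prolate spheroidal wave function of bandwidth `c`, and `χ = χ_n(c)`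
is its eigenvalue: `ψ` is an eigenfunction of `L_c` for the `n`-th eigenvalue, it has norm one in
`L²(I)`, and its sign is fixed by `ψ(0) > 0` for even `n` and `ψ'(0) > 0` for odd `n`. -/
structure IsPSWF (c : ℝ) (n : ℕ) (χ : ℝ) (ψ : ℝ → ℝ) : Prop where
  nth_eigenvalue : IsNthProlateEigenvalue c n χ
  eigenfunction : IsProlateEigenfunction c χ ψ
  norm_one : ∫ x in (-1 : ℝ)..1, |ψ x| ^ 2 = 1
  sign_even : Even n → 0 < ψ 0
  sign_odd : Odd n → 0 < deriv ψ 0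

namespace IsProlateEigenfunction

variable {c χ : ℝ} {f : ℝ → ℝ}

/-! Differentiating the equation `k` times at `0` gives, for `a_k = f^(k)(0)`, the recurrence
`a_(k+2) = (k(k+1) - χ) a_k + k(k-1) c² a_(k-2)` (`iteratedDeriv_add_two`). While `k(k+1) ≤ χ` the
first coefficient is nonpositive and the second nonnegative, so both the bound and the alternation
of signs follow by induction. Only the odd base case is delicate: `a_3 = (2 - χ) a_1` forces `χ ≠
2`. There `f` vanishes at `0` (`apply_zero_mul_deriv_zero`), and comparison with the Legendre
solution `x` excludes `χ = 2` (`ne_two`). -/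

lemma contDiffAt_two (h : IsProlateEigenfunction c χ f) {x : ℝ} (hx : x ∈ Set.Ioo (-1 : ℝ) 1) :
    ContDiffAt ℝ 2 f x :=
  h.contDiffOn.contDiffAt (Icc_mem_nhds hx.1 hx.2)

lemma hasDerivAt (h : IsProlateEigenfunction c χ f) {x : ℝ} (hx : x ∈ Set.Ioo (-1 : ℝ) 1) :
    HasDerivAt f (deriv f x) x :=
  ((h.contDiffAt_two hx).differentiableAt (by norm_num)).hasDerivAt

lemma hasDerivAt_deriv (h : IsProlateEigenfunction c χ f) {x : ℝ}
    (hx : x ∈ Set.Ioo (-1 : ℝ) 1) : HasDerivAt (deriv f) (deriv (deriv f) x) x := by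
  have h1 : ContDiffOn ℝ 1 (deriv f) (Set.Ioo (-1) 1) :=
    (h.contDiffOn.mono Set.Ioo_subset_Icc_self).deriv_of_isOpen isOpen_Ioo (by norm_num)
  exact ((h1.contDiffAt (Ioo_mem_nhds hx.1 hx.2)).differentiableAt (by norm_num)).hasDerivAt

lemma ode (h : IsProlateEigenfunction c χ f) {x : ℝ} (hx : x ∈ Set.Ioo (-1 : ℝ) 1) :
    (1 - x ^ 2) * deriv (deriv f) x - 2 * x * deriv f x + (χ - c ^ 2 * x ^ 2) * f x = 0 := by
  have h1 := h.eq x hx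
  have h2 : HasDerivAt (fun t : ℝ => 1 - t ^ 2) (-(2 * x)) x := by
    simpa using (hasDerivAt_pow 2 x).const_sub 1
  have h3 := (h2.mul (h.hasDerivAt_deriv hx)).deriv
  have h4 : deriv (fun t => (1 - t ^ 2) * deriv f t) x =
      -(2 * x) * deriv f x + (1 - x ^ 2) * deriv (deriv f) x := h3
  rw [prolateOp, h4] at h1
  linarith

/-- The self-adjoint form of the equation. -/
lemma hasDerivAt_flux (h : IsProlateEigenfunction c χ f) {x : ℝ}
    (hx : x ∈ Set.Ioo (-1 : ℝ) 1) :
    HasDerivAt (fun t => (1 - t ^ 2) * deriv f t) ((c ^ 2 * x ^ 2 - χ) * f x) x := by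
  have h2 : HasDerivAt (fun t : ℝ => 1 - t ^ 2) (-(2 * x)) x := by
    simpa using (hasDerivAt_pow 2 x).const_sub 1
  refine (h2.mul (h.hasDerivAt_deriv hx)).congr_deriv ?_
  linarith [h.ode hx]

lemma contDiffOn_nat (h : IsProlateEigenfunction c χ f) (n : ℕ) :
    ContDiffOn ℝ n f (Set.Ioo (-1) 1) ∧ ContDiffOn ℝ n (deriv f) (Set.Ioo (-1) 1) := by
  have hd : DifferentiableOn ℝ f (Set.Ioo (-1) 1) := fun x hx =>
    (h.hasDerivAt hx).differentiableAt.differentiableWithinAt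
  have hd' : DifferentiableOn ℝ (deriv f) (Set.Ioo (-1) 1) := fun x hx =>
    (h.hasDerivAt_deriv hx).differentiableAt.differentiableWithinAt
  induction n with
  | zero => exact ⟨contDiffOn_zero.2 hd.continuousOn, contDiffOn_zero.2 hd'.continuousOn⟩
  | succ n ih =>
    push_cast
    refine ⟨(contDiffOn_succ_iff_deriv_of_isOpen isOpen_Ioo).2 ⟨hd, by simp, ih.2⟩,
      (contDiffOn_succ_iff_deriv_of_isOpen isOpen_Ioo).2 ⟨hd', by simp, ?_⟩⟩
    have hne : ∀ x ∈ Set.Ioo (-1 : ℝ) 1, 1 - x ^ 2 ≠ 0 := fun x hx => by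
      nlinarith [hx.1, hx.2, mul_pos (sub_pos.2 hx.1) (sub_pos.2 hx.2)]
    have hs : ContDiffOn ℝ n
        (fun x => (2 * x * deriv f x - (χ - c ^ 2 * x ^ 2) * f x) / (1 - x ^ 2))
        (Set.Ioo (-1) 1) := by
      refine ContDiffOn.div (ContDiffOn.sub ?_ ?_) (by fun_prop) hne
      · exact ContDiffOn.mul (by fun_prop) ih.2
      · exact ContDiffOn.mul (by fun_prop) ih.1
    refine hs.congr fun x hx => ?_
    rw [eq_div_iff (hne x hx)]
    linarith [h.ode hx]

lemma contDiffOn_infty (h : IsProlateEigenfunction c χ f) :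
    ContDiffOn ℝ ∞ f (Set.Ioo (-1) 1) :=
  _root_.contDiffOn_infty.2 fun n => (h.contDiffOn_nat n).1

/-! ### Higher derivatives and the recurrence at the origin. -/

lemma hasDerivAt_iteratedDeriv (h : IsProlateEigenfunction c χ f) (m : ℕ) {x : ℝ}
    (hx : x ∈ Set.Ioo (-1 : ℝ) 1) :
    HasDerivAt (iteratedDeriv m f) (iteratedDeriv (m + 1) f x) x := by
  have h1 : DifferentiableOn ℝ (iteratedDerivWithin m f (Set.Ioo (-1) 1)) (Set.Ioo (-1) 1) :=
    h.contDiffOn_infty.differentiableOn_iteratedDerivWithin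
      (by exact_mod_cast WithTop.coe_lt_top _) (uniqueDiffOn_Ioo _ _)
  have h2 : DifferentiableAt ℝ (iteratedDeriv m f) x :=
    (h1.congr (iteratedDerivWithin_of_isOpen isOpen_Ioo).symm).differentiableAt
      (Ioo_mem_nhds hx.1 hx.2)
  rw [iteratedDeriv_succ]
  exact h2.hasDerivAt

/-- The equation satisfied by the successive derivatives of an eigenfunction. -/
lemma ode_iteratedDeriv (h : IsProlateEigenfunction c χ f) (k : ℕ) :
    ∀ x ∈ Set.Ioo (-1 : ℝ) 1,
      (1 - x ^ 2) * iteratedDeriv (k + 2) f x - 2 * (k + 1) * x * iteratedDeriv (k + 1) f x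
        + (χ - k * (k + 1) - c ^ 2 * x ^ 2) * iteratedDeriv k f x
        - 2 * k * c ^ 2 * x * iteratedDeriv (k - 1) f x
        - k * (k - 1) * c ^ 2 * iteratedDeriv (k - 2) f x = 0 := by
  induction k with
  | zero =>
    intro x hx
    have := h.ode hx
    simp only [iteratedDeriv_succ, iteratedDeriv_zero]
    push_cast
    linarith
  | succ k ih =>
    intro x hx
    have e2 := h.hasDerivAt_iteratedDeriv (k + 2) hx
    have e1 := h.hasDerivAt_iteratedDeriv (k + 1) hx
    have e0 := h.hasDerivAt_iteratedDeriv k hx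
    have d1 := h.hasDerivAt_iteratedDeriv (k - 1) hx
    have d2 := h.hasDerivAt_iteratedDeriv (k - 2) hx
    have hid := hasDerivAt_id x
    have hsq : HasDerivAt (fun t : ℝ => t ^ 2) (2 * x) x := by
      simpa using hasDerivAt_pow 2 x
    have H := (((((hsq.const_sub 1).mul e2).sub ((hid.const_mul (2 * ((k : ℝ) + 1))).mul e1)).add
      (((hsq.const_mul (c ^ 2)).const_sub (χ - k * (k + 1))).mul e0)).sub
      ((hid.const_mul (2 * k * c ^ 2)).mul d1)).sub (d2.const_mul ((k : ℝ) * (k - 1) * c ^ 2))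
    have H0 := H.unique ((hasDerivAt_const x (0 : ℝ)).congr_of_eventuallyEq
      (Filter.eventuallyEq_of_mem (Ioo_mem_nhds hx.1 hx.2) ih))
    simp only [id] at H0
    -- For `k = 0, 1` the truncated indices `k - 1`, `k - 2` are spurious, but the factors `k`, `k *
    -- (k - 1)` kill those terms.
    rcases k with _ | _ | k
    · simp at H0 ⊢
      linarith
    · simp at H0 ⊢
      linarith
    · simp only [Nat.add_sub_cancel, show k + 1 + 1 - 1 = k + 1 by lia,
        show k + 1 + 1 + 1 - 2 = k + 1 by lia, show k + 1 + 1 - 2 = k by lia] at H0 ⊢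
      push_cast at H0 ⊢
      linarith

/-- The three-term recurrence for the derivatives at the origin. -/
lemma iteratedDeriv_add_two (h : IsProlateEigenfunction c χ f) (k : ℕ) :
    iteratedDeriv (k + 2) f 0 = (k * (k + 1) - χ) * iteratedDeriv k f 0
      + k * (k - 1) * c ^ 2 * iteratedDeriv (k - 2) f 0 := by
  have := h.ode_iteratedDeriv k 0 (by norm_num)
  norm_num at this
  linarith

/-- Since `c² ≤ s²`, both terms of the recurrence are multiples of `s^k M`, with total coefficient
at most `χ - k(k+1) + k(k-1) = χ - 2k ≤ s²`. -/
lemma abs_iteratedDeriv_le (h : IsProlateEigenfunction c χ f) {s M : ℝ} (hs : 0 < s)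
    (hsχ : s ^ 2 = χ) (hc : c ^ 2 ≤ χ) (h0 : |f 0| ≤ M) (h1 : |deriv f 0| ≤ s * M) (k : ℕ)
    (hk : (k : ℝ) * (k + 1) ≤ χ) : |iteratedDeriv k f 0| ≤ s ^ k * M := by
  induction k using Nat.strong_induction_on with
  | _ k ih =>
  have hM : 0 ≤ M := (abs_nonneg _).trans h0
  rcases k with _ | _ | k
  · simpa using h0
  · simpa using h1
  · push_cast at hk
    have hk0 : (0 : ℝ) ≤ k := k.cast_nonneg
    have hk' : (k : ℝ) * (k + 1) ≤ χ := by nlinarith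
    have hkk : (0 : ℝ) ≤ k * (k - 1) := by
      rcases k with _ | k
      · simp
      · push_cast; ring_nf; positivity
    have b0 := ih k (by lia) hk'
    have b2 : (k : ℝ) * (k - 1) * c ^ 2 * |iteratedDeriv (k - 2) f 0| ≤
        k * (k - 1) * (s ^ k * M) := by
      rcases k with _ | _ | k
      · simp
      · simp
      · have b := ih k (by lia) (by push_cast at hk' hk0; nlinarith)
        rw [mul_assoc _ (c ^ 2)]
        refine mul_le_mul_of_nonneg_left ?_ hkk
        calc c ^ 2 * |iteratedDeriv k f 0| ≤ s ^ 2 * (s ^ k * M) := by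
              have : 0 ≤ χ := (sq_nonneg c).trans hc
              rw [hsχ]; gcongr
          _ = s ^ (k + 2) * M := by ring
    rw [h.iteratedDeriv_add_two k]
    calc _ ≤ (χ - k * (k + 1)) * |iteratedDeriv k f 0|
          + k * (k - 1) * c ^ 2 * |iteratedDeriv (k - 2) f 0| := by
          refine (abs_add_le _ _).trans (le_of_eq ?_)
          rw [abs_mul, abs_mul, abs_of_nonpos (by linarith : (k : ℝ) * (k + 1) - χ ≤ 0),
            abs_of_nonneg (by positivity : (0 : ℝ) ≤ k * (k - 1) * c ^ 2)]
          ring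
      _ ≤ (χ - k * (k + 1)) * (s ^ k * M) + k * (k - 1) * (s ^ k * M) := by
          gcongr
      _ = s ^ (k + 2) * M - 2 * k * (s ^ k * M) := by rw [pow_add, hsχ]; ring
      _ ≤ _ := by
          have : 0 ≤ 2 * k * (s ^ k * M) := by positivity
          linarith

/-- Multiply the recurrence by `a_k`. For `k ≥ 2` the term with `a_k a_(k-2)` is strictly negative
by induction, so `k(k+1) = χ` is harmless; for `k = 1` that term is absent. -/
lemma iteratedDeriv_mul_neg (h : IsProlateEigenfunction c χ f) (hc : 0 < c) (hχ : 0 < χ)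
    (k : ℕ) (hk : (k : ℝ) * (k + 1) ≤ χ) (h0 : k % 2 = 0 → f 0 ≠ 0)
    (h1 : k % 2 = 1 → deriv f 0 ≠ 0 ∧ χ ≠ 2) :
    iteratedDeriv k f 0 * iteratedDeriv (k + 2) f 0 < 0 := by
  induction k using Nat.strong_induction_on with
  | _ k ih =>
  have hr := h.iteratedDeriv_add_two k
  rcases k with _ | _ | k
  · rw [hr]
    have := mul_pos hχ (pow_pos (abs_pos.2 (h0 rfl)) 2)
    rw [sq_abs] at this
    simp only [iteratedDeriv_zero]
    push_cast
    linarith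
  · rw [hr]
    obtain ⟨ha, h2⟩ := h1 rfl
    push_cast at hk
    have h3 : 0 < χ - 2 := sub_pos.2 (lt_of_le_of_ne (by linarith) h2.symm)
    have := mul_pos h3 (pow_pos (abs_pos.2 ha) 2)
    rw [sq_abs] at this
    simp only [zero_add, iteratedDeriv_one]
    push_cast
    linarith
  · have hk0 : (0 : ℝ) ≤ k := k.cast_nonneg
    push_cast at hk hr
    have hi := ih k (by lia) (by nlinarith) (fun e => h0 (by lia)) (fun e => h1 (by lia))
    rw [hr]
    have t1 : ((k : ℝ) + 1 + 1) * (k + 1 + 1 + 1) - χ ≤ 0 := by linarith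
    have t2 : 0 < ((k : ℝ) + 1 + 1) * (k + 1 + 1 - 1) * c ^ 2 := by
      have : (0 : ℝ) < k + 1 + 1 - 1 := by linarith
      positivity
    have t3 := mul_neg_of_pos_of_neg t2 hi
    have t4 := mul_nonpos_of_nonpos_of_nonneg t1 (sq_nonneg (iteratedDeriv (k + 2) f 0))
    linarith

/-! ### Exclusion of `χ = 2` in the odd case. -/

/-- An eigenfunction is even or odd; here only the consequence at the origin, read off from the
vanishing of the Wronskian of `f` and its reflection at the singular end point. -/
lemma apply_zero_mul_deriv_zero (h : IsProlateEigenfunction c χ f) : f 0 * deriv f 0 = 0 := by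
  -- `deriv f` at `±1` depends on values outside `I`; the one-sided derivative is continuous up to
  -- the ends, so the factor `1 - x²` makes `W 1 = 0`.
  set G := derivWithin f (Set.Icc (-1) 1)
  have hGc : ContinuousOn G (Set.Icc (-1) 1) :=
    h.contDiffOn.continuousOn_derivWithin (uniqueDiffOn_Icc (by norm_num)) (by norm_num)
  have hGd : ∀ x ∈ Set.Ioo (-1 : ℝ) 1, G x = deriv f x := fun x hx =>
    derivWithin_of_mem_nhds (Icc_mem_nhds hx.1 hx.2)
  let W : ℝ → ℝ := fun x => (1 - x ^ 2) * (f x * G (-x) + G x * f (-x))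
  have hsub : Set.Icc (0 : ℝ) 1 ⊆ Set.Icc (-1) 1 := Set.Icc_subset_Icc_left (by norm_num)
  have hneg : Set.MapsTo (fun x : ℝ => -x) (Set.Icc 0 1) (Set.Icc (-1) 1) := fun x hx =>
    ⟨by linarith [hx.2], by linarith [hx.1]⟩
  have hfc := h.contDiffOn.continuousOn
  have hWc : ContinuousOn W (Set.Icc 0 1) := by
    refine ContinuousOn.mul (by fun_prop) (ContinuousOn.add ?_ ?_)
    · exact (hfc.mono hsub).mul (hGc.comp continuous_neg.continuousOn hneg)
    · exact (hGc.mono hsub).mul (hfc.comp continuous_neg.continuousOn hneg)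
  have hW' : ∀ x ∈ Set.Ico (0 : ℝ) 1, HasDerivWithinAt W 0 (Set.Ici x) x := by
    intro x hx
    have hx1 : x ∈ Set.Ioo (-1 : ℝ) 1 := ⟨by linarith [hx.1], hx.2⟩
    have hx2 : -x ∈ Set.Ioo (-1 : ℝ) 1 := ⟨by linarith [hx.2], by linarith [hx.1]⟩
    have a1 := h.hasDerivAt hx1
    have a2 := (h.hasDerivAt hx2).comp x (hasDerivAt_neg x)
    have b1 := h.hasDerivAt_flux hx1
    have b2 := (h.hasDerivAt_flux hx2).comp x (hasDerivAt_neg x)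
    have H := (a1.mul b2).add (b1.mul a2)
    refine HasDerivAt.hasDerivWithinAt ?_
    refine (H.congr_deriv ?_).congr_of_eventuallyEq
      (Filter.eventuallyEq_of_mem (Ioo_mem_nhds hx1.1 hx1.2) fun y hy => ?_)
    · simp only [Function.comp]
      ring
    · have hy2 : -y ∈ Set.Ioo (-1 : ℝ) 1 := ⟨by linarith [hy.2], by linarith [hy.1]⟩
      simp only [W, hGd y hy, hGd (-y) hy2, Pi.add_apply, Pi.mul_apply, Function.comp]
      ring
  have h10 := constant_of_has_deriv_right_zero hWc hW' 1 (by norm_num)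
  simp only [W, hGd 0 (by norm_num), neg_zero] at h10
  norm_num at h10
  rcases mul_eq_zero.1 (show f 0 * deriv f 0 = 0 by linarith) with h | h <;> simp [h]

/-- For an eigenfunction vanishing at the origin, the eigenvalue differs from that of `x ↦ x` for
`c = 0`, by Picone's identity. -/
lemma ne_two (h : IsProlateEigenfunction c χ f) (hc : 0 < c) (h0 : f 0 = 0)
    (h1 : deriv f 0 ≠ 0) : χ ≠ 2 := by
  rintro rfl
  set G := derivWithin f (Set.Icc (-1) 1)
  have hGc : ContinuousOn G (Set.Icc (-1) 1) :=
    h.contDiffOn.continuousOn_derivWithin (uniqueDiffOn_Icc (by norm_num)) (by norm_num)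
  have hGd : ∀ x ∈ Set.Ioo (-1 : ℝ) 1, G x = deriv f x := fun x hx =>
    derivWithin_of_mem_nhds (Icc_mem_nhds hx.1 hx.2)
  have hfc := h.contDiffOn.continuousOn
  have hsub : Set.Icc (0 : ℝ) 1 ⊆ Set.Icc (-1) 1 := Set.Icc_subset_Icc_left (by norm_num)
  have hsl : ContinuousOn (dslope f 0) (Set.Icc (-1) 1) :=
    (continuousOn_dslope (Icc_mem_nhds (by norm_num) (by norm_num))).2
      ⟨hfc, (h.hasDerivAt (by norm_num)).differentiableAt⟩
  -- Picone's function `(1 - x²)(f f' - f²/x)`, with `dslope` extending `f/x` to `0`. It vanishes at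
  -- `0` and `1` and is nondecreasing, hence zero; then `F' = 0` forces `f = 0` on `(0, 1)`.
  let F : ℝ → ℝ := fun x => (1 - x ^ 2) * (f x * (G x - dslope f 0 x))
  have hFc : ContinuousOn F (Set.Icc 0 1) :=
    (ContinuousOn.mul (by fun_prop) (hfc.mul (hGc.sub hsl))).mono hsub
  have hF' : ∀ x ∈ Set.Ioo (0 : ℝ) 1, HasDerivAt F
      (c ^ 2 * x ^ 2 * f x ^ 2 + (1 - x ^ 2) * (deriv f x - f x / x) ^ 2) x := by
    intro x hx
    have hx1 : x ∈ Set.Ioo (-1 : ℝ) 1 := ⟨by linarith [hx.1], hx.2⟩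
    have hxne : x ≠ 0 := hx.1.ne'
    have a := h.hasDerivAt hx1
    have hsq : HasDerivAt (fun t : ℝ => 1 - t ^ 2) (-(2 * x)) x := by
      simpa using (hasDerivAt_pow 2 x).const_sub 1
    have H := ((h.hasDerivAt_flux hx1).mul a).sub
      (hsq.mul ((a.pow 2).div (hasDerivAt_id x) hxne))
    refine (H.congr_deriv ?_).congr_of_eventuallyEq
      (Filter.eventuallyEq_of_mem (Ioo_mem_nhds hx.1 hx.2) fun y hy => ?_)
    · simp only [id, Pi.pow_apply, Pi.div_apply]
      field_simp
      ring
    · have hy1 : y ∈ Set.Ioo (-1 : ℝ) 1 := ⟨by linarith [hy.1], hy.2⟩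
      have hyne : y ≠ 0 := hy.1.ne'
      simp only [F, hGd y hy1, dslope_of_ne f hyne, slope_def_field, h0, Pi.sub_apply,
        Pi.mul_apply, Pi.pow_apply, Pi.div_apply, id]
      field_simp
      ring
  have hpos : ∀ x ∈ Set.Ioo (0 : ℝ) 1, 0 ≤ (1 - x ^ 2) * (deriv f x - f x / x) ^ 2 :=
    fun x hx => mul_nonneg (by nlinarith [hx.1, hx.2]) (sq_nonneg _)
  have hmono : MonotoneOn F (Set.Icc 0 1) := by
    refine monotoneOn_of_deriv_nonneg (convex_Icc 0 1) hFc ?_ ?_ <;> rw [interior_Icc]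
    · exact fun x hx => (hF' x hx).differentiableAt.differentiableWithinAt
    · intro x hx
      rw [(hF' x hx).deriv]
      have := hpos x hx
      positivity
  have hF0 : ∀ x ∈ Set.Ioo (0 : ℝ) 1, F x = 0 := by
    intro x hx
    have hx' := Set.Ioo_subset_Icc_self hx
    have l := hmono (Set.left_mem_Icc.2 zero_le_one) hx' hx'.1
    have r := hmono hx' (Set.right_mem_Icc.2 zero_le_one) hx'.2
    simp only [F, h0] at l r ⊢
    norm_num at l r
    linarith
  have hf0 : ∀ x ∈ Set.Ioo (0 : ℝ) 1, f x = 0 := by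
    intro x hx
    have e := (hF' x hx).unique ((hasDerivAt_const x (0 : ℝ)).congr_of_eventuallyEq
      (Filter.eventuallyEq_of_mem (Ioo_mem_nhds hx.1 hx.2) hF0))
    have hx0 := hx.1
    have h2 : 0 ≤ c ^ 2 * x ^ 2 * f x ^ 2 := by positivity
    have h3 : c ^ 2 * x ^ 2 * f x ^ 2 = 0 := by linarith [hpos x hx]
    have h4 : c ^ 2 * x ^ 2 ≠ 0 := by positivity
    exact pow_eq_zero_iff (two_ne_zero) |>.1 ((mul_eq_zero.1 h3).resolve_left h4)
  have hne : ∀ᶠ x in nhdsWithin (0 : ℝ) (Set.Ioi 0), f x ≠ 0 :=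
    ((h.hasDerivAt (x := 0) (by norm_num)).eventually_ne h1).filter_mono
      (nhdsWithin_mono _ fun x hx => ne_of_gt hx)
  obtain ⟨x, hx, hx'⟩ := (hne.and (Ioo_mem_nhdsGT (zero_lt_one' ℝ))).exists
  exact hx (hf0 x hx')

end IsProlateEigenfunction

theorem proposition1 (c : ℝ) (hc : 0 < c) (n : ℕ) (χ : ℝ) (ψ : ℝ → ℝ)
    (hψ : IsPSWF c n χ ψ) (hχ : c ^ 2 < χ) :
    ContDiffOn ℝ ∞ ψ (Set.Ioo (-1) 1) ∧
    (∀ k : ℕ, (k : ℝ) * ((k : ℝ) + 1) ≤ χ →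
      |iteratedDeriv k ψ 0| ≤
        (Real.sqrt χ) ^ k * Real.sqrt (|ψ 0| ^ 2 + χ⁻¹ * |deriv ψ 0| ^ 2)) ∧
    (∀ k : ℕ, (k : ℝ) * ((k : ℝ) + 1) ≤ χ → k % 2 = n % 2 →
      iteratedDeriv k ψ 0 * iteratedDeriv (k + 2) ψ 0 < 0) := by
  have h := hψ.eigenfunction
  have hχ0 : 0 < χ := lt_of_le_of_lt (sq_nonneg c) hχ
  refine ⟨h.contDiffOn_infty, fun k hk => ?_, fun k hk hkn => ?_⟩
  · refine h.abs_iteratedDeriv_le (Real.sqrt_pos.2 hχ0) (Real.sq_sqrt hχ0.le) hχ.le ?_ ?_ k hk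
    · refine Real.le_sqrt_of_sq_le ?_
      have : 0 ≤ χ⁻¹ * |deriv ψ 0| ^ 2 := by positivity
      linarith
    · rw [← Real.sqrt_mul hχ0.le]
      refine Real.le_sqrt_of_sq_le ?_
      rw [mul_add, mul_inv_cancel_left₀ hχ0.ne']
      have : 0 ≤ χ * |ψ 0| ^ 2 := by positivity
      linarith
  · refine h.iteratedDeriv_mul_neg hc hχ0 k hk
      (fun e => (hψ.sign_even (Nat.even_iff.2 (hkn ▸ e))).ne') fun e => ?_
    have hd := (hψ.sign_odd (Nat.odd_iff.2 (hkn ▸ e))).ne'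
    exact ⟨hd, h.ne_two hc ((mul_eq_zero.1 h.apply_zero_mul_deriv_zero).resolve_right hd) hd⟩
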